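/- Let $N\ge 1$ and let $X=(X_t)_{t\ge 0}$ be a (possibly time-inhomogeneous) continuous-time Markov chain with states $e_1,\dots,e_N$ on a filtered probability space $(\Omega,(\mathcal F_t)_{t\ge0},\mathbb Q)$: $X$ is adapted, has càdlàg paths and no fixed times of jump ($\mathbb Q(X_{t-}\ne X_t)=0$ for every $t>0$), is Markov with respect to $(\mathcal F_t)$ with transition probabilities $p_{i,j}(t,s)=\mathbb Q(X_s=e_j\mid X_t=e_i)$, $t\le s$, and has generator $A^{\mathbb Q}(t)=[a^{\mathbb Q}_{i,j}(t)]$, where $0\le a^{\mathbb Q}_{i,j}(t)=\lim_{h\downarrow0}p_{i,j}(t,t+h)/h$ for $i\neq j$ (for every state with $\mathbb Q(X_t=e_i)>0$) and $a^{\mathbb Q}_{i,i}(t)=-\sum_{j\ne i}a^{\mathbb Q}_{i,j}(t)$. Let $r_i>0$ (short rates), $h_i>0$ (default intensities), $0\le L_i\le 1$ (loss rates), $i=1,\dots,N$, be constants, write $r_s=r_i$, $h_s=h_i$, $L_s=L_i$ on $\{X_s=e_i\}$, let $T>0$, and let $\Xi:\{e_1,\dots,e_N\}\to\mathbb R$.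 For $t\in(0,T)$ the pre-default price function in regime $i$ is $$\Psi_i(t)=\Psi_i[\Xi](t;T)=\mathbb E^{\mathbb Q}\Big[\Xi(X_T)\,e^{-\int_t^T(r_s+h_sL_s)\,ds}\;\Big|\;X_t=e_i\Big].$$ Suppose that for all $i\ne j$ $$0<\inf_{s\in[0,T]}|a^{\mathbb Q}_{i,j}(s)|\le\sup_{s\in[0,T]}|a^{\mathbb Q}_{i,j}(s)|<\infty,$$ that $a^{\mathbb Q}_{i,j}$ is continuously differentiable on $(0,T)$, and that $\sup_{s\in(0,T)}\big|\tfrac{d}{ds}a^{\mathbb Q}_{i,j}(s)\big|<\infty$. Then for every $i\in\{1,\dots,N\}$ the function $\Psi_i$ is well defined on $(0,T)$ (that is, $\mathbb Q(X_t=e_i)>0$ and the discounted payoff is integrable given $X_t=e_i$, for all $t\in(0,T)$) and continuously differentiable on $(0,T)$. -/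

import Mathlib

open Set Filter Topology MeasureTheory ProbabilityTheory
open scoped NNReal ENNReal

namespace RegimeSwitching

/-- The transition probability `p_{i,j}(t,s) = Q(X_s = e_j | X_t = e_i)` of a process on the
regimes `e_1, …, e_N` (the regime `e_i` is represented by its index `i`). -/
noncomputable def transProb {N : ℕ} {Ω : Type*} [MeasurableSpace Ω] (Q : Measure Ω)
    (X : ℝ≥0 → Ω → Fin N) (t s : ℝ≥0) (i j : Fin N) : ℝ :=
  (Q[|X t ⁻¹' {i}]).real (X s ⁻¹' {j})

/-- `X` is, under `Q` and with respect to the filtration `𝓕`, a (possibly inhomogeneous)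
continuous-time Markov chain with finitely many regimes and with generator `A(t) = [a_{i,j}(t)]`:
an adapted process with càdlàg paths and no fixed times of jump, with the Markov property,
and with
`a_{i,j}(t) = lim_{h ↓ 0} p_{i,j}(t,t+h)/h` for `i ≠ j`, `a_{i,i}(t) = -∑_{j ≠ i} a_{i,j}(t)`. -/
structure IsMarkovChain {N : ℕ} {Ω : Type*} [mΩ : MeasurableSpace Ω] (Q : Measure Ω)
    (𝓕 : Filtration ℝ≥0 mΩ) (X : ℝ≥0 → Ω → Fin N) (A : ℝ → Matrix (Fin N) (Fin N) ℝ) :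
    Prop where
  adapted : Adapted 𝓕 X
  /-- Almost every path is right-continuous (the set of regimes is discrete). -/
  right_continuous : ∀ᵐ ω ∂Q, ∀ t : ℝ≥0, ContinuousWithinAt (fun s => X s ω) (Ici t) t
  /-- Almost every path has left limits. -/
  left_limits : ∀ᵐ ω ∂Q, ∀ t : ℝ≥0, 0 < t → ∃ i, Tendsto (fun s => X s ω) (𝓝[<] t) (𝓝 i)
  /-- `Q(X_{t-} ≠ X_t) = 0` for every fixed time `t > 0`. -/
  no_fixed_jump : ∀ t : ℝ≥0, 0 < t →
    ∀ᵐ ω ∂Q, Tendsto (fun s => X s ω) (𝓝[<] t) (𝓝 (X t ω))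
  /-- The Markov property `Q(X_s = e_j | 𝓕_t) = p_{X_t,j}(t,s)`. -/
  markov : ∀ t s : ℝ≥0, t ≤ s → ∀ j : Fin N,
    Q⟦X s ⁻¹' {j} | 𝓕 t⟧ =ᵐ[Q] fun ω => transProb Q X t s (X t ω) j
  rate_nonneg : ∀ (t : ℝ≥0) (i j : Fin N), i ≠ j → 0 ≤ A t i j
  /-- The conditional probabilities `p_{i,j}(t,t+h)` only make sense if `Q(X_t = e_i) > 0`. -/
  rate : ∀ (t : ℝ≥0) (i j : Fin N), i ≠ j → Q (X t ⁻¹' {i}) ≠ 0 →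
    Tendsto (fun δ : ℝ≥0 => transProb Q X t (t + δ) i j / (δ : ℝ)) (𝓝[>] 0) (𝓝 (A t i j))
  rate_diag : ∀ (t : ℝ≥0) (i : Fin N), A t i i = -∑ j ∈ Finset.univ.erase i, A t i j

/-- The promised payoff `Ξ(X_T)`, discounted from `T` to `t` at the default-adjusted rate:
`Ξ(X_T) exp(-∫_t^T (r_s + h_s L_s) ds)` with `r_s = r_i`, `h_s = h_i`, `L_s = L_i`
while `X_s = e_i`. -/
noncomputable def discountedPayoff {N : ℕ} {Ω : Type*} (X : ℝ≥0 → Ω → Fin N)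
    (r h L Ξ : Fin N → ℝ) (T t : ℝ) (ω : Ω) : ℝ :=
  Ξ (X T.toNNReal ω) *
    Real.exp (-∫ s in t..T,
      (r (X s.toNNReal ω) + h (X s.toNNReal ω) * L (X s.toNNReal ω)))

/-- The pre-default price function
`Ψ_i[Ξ](t;T) = E^Q[Ξ(X_T) exp(-∫_t^T (r_s + h_s L_s) ds) | X_t = e_i]`. -/
noncomputable def preDefaultPrice {N : ℕ} {Ω : Type*} [MeasurableSpace Ω] (Q : Measure Ω)
    (X : ℝ≥0 → Ω → Fin N) (r h L Ξ : Fin N → ℝ) (T : ℝ) (i : Fin N) (t : ℝ) : ℝ :=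
  ∫ ω, discountedPayoff X r h L Ξ T t ω ∂(Q[|X t.toNNReal ⁻¹' {i}])

end RegimeSwitching

/-! The price is identified with a component of the solution `u` of the linear backward system `u' =
R u - A u`, `u(T) = Ξ`, where `R = r + h L`; smoothness in time is then read off the equation. The
rates have bounded derivative on `(0, T)`, so they extend continuously to the line and the linear
system is solvable up to both endpoints.

The identification is `feynmanKac`. Fix `a`, let `D_s` be the discount factor from `a` to `s`, and
set `g(s) = E[1_{X_a = i} D_s u(s, X_s)]`. The Markov property and the generator give the right
derivative of `s ↦ E[Z v(s, X_s)]` for `Z` known at time `t` (`hasDerivWithinAt_integral`). Adding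
the derivative of `D_s`, the backward equation makes the right derivative of `g` vanish. Since the
chain has no fixed jump times, `g` is continuous, hence constant; comparing `g(T)` with `g(a)` and
dividing by `Q(X_a = i)` gives the claim.

That this mass is positive comes from the forward equation: `e^{Ct} Q(X_t = i)` is nondecreasing, so
if it vanishes at some `t > 0` it vanishes on `[0, t]`. The inflow into `i` at time `0` is then
zero, and positive rates leave no initial mass anywhere (`measure_preimage_pos`). -/

namespace RegimeSwitching

/-! ### Linear initial and terminal value problems -/

/-- Coordinatewise truncation of a vector to the box `[-c, c]^ι`. -/
def clamp {ι : Type*} (c : ℝ) (x : ι → ℝ) : ι → ℝ := fun i => max (-c) (min c (x i))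

theorem norm_clamp_le {ι : Type*} [Fintype ι] {c : ℝ} (hc : 0 ≤ c) (x : ι → ℝ) :
    ‖clamp c x‖ ≤ c := by
  rw [pi_norm_le_iff_of_nonneg hc]
  intro i
  rw [Real.norm_eq_abs, abs_le]
  exact ⟨le_max_left _ _, max_le (by linarith) (min_le_left _ _)⟩

theorem norm_clamp_le_norm {ι : Type*} [Fintype ι] {c : ℝ} (hc : 0 ≤ c) (x : ι → ℝ) :
    ‖clamp c x‖ ≤ ‖x‖ := by
  rw [pi_norm_le_iff_of_nonneg (norm_nonneg x)]
  intro i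
  refine le_trans ?_ (norm_le_pi_norm x i)
  simp only [Real.norm_eq_abs, clamp]
  grind

theorem clamp_eq_self {ι : Type*} [Fintype ι] {c : ℝ} {x : ι → ℝ} (hx : ‖x‖ ≤ c) :
    clamp c x = x := by
  ext i
  have := abs_le.1 ((Real.norm_eq_abs _ ▸ norm_le_pi_norm x i).trans hx)
  rw [clamp, min_eq_right this.2, max_eq_right this.1]

theorem lipschitzWith_clamp {ι : Type*} [Fintype ι] (c : ℝ) :
    LipschitzWith 1 (clamp c : (ι → ℝ) → ι → ℝ) := by
  refine LipschitzWith.of_dist_le_mul fun x y => ?_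
  rw [NNReal.coe_one, one_mul, dist_pi_le_iff dist_nonneg]
  intro i
  refine le_trans ?_ (dist_le_pi_dist x y i)
  simp only [Real.dist_eq, clamp]
  grind

/-- A linear initial value problem on `[0, T]` with continuous coefficients has a solution on the
whole interval. -/
theorem exists_hasDerivWithinAt_linear {ι : Type*} [Fintype ι]
    {B : ℝ → (ι → ℝ) →L[ℝ] (ι → ℝ)} {T : ℝ} (hT : 0 ≤ T) (hB : ContinuousOn B (Icc 0 T))
    (x₀ : ι → ℝ) :
    ∃ u : ℝ → ι → ℝ, u 0 = x₀ ∧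
      ∀ t ∈ Icc 0 T, HasDerivWithinAt u (B t (u t)) (Icc 0 T) t := by
  obtain ⟨M', hM'⟩ := isCompact_Icc.exists_bound_of_continuousOn hB
  obtain ⟨M, hM0, hM⟩ : ∃ M : ℝ, 0 ≤ M ∧ ∀ t ∈ Icc 0 T, ‖B t‖ ≤ M :=
    ⟨max M' 0, le_max_right _ _, fun t ht => (hM' t ht).trans (le_max_left _ _)⟩
  -- The Grönwall bound that any solution must obey. Truncating at this level makes the field
  -- globally bounded by `M * c`, so Picard–Lindelöf covers all of `[0, T]` with no smallness
  -- condition.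
  set c : ℝ := ‖x₀‖ * Real.exp (M * T) with hc
  have hc0 : 0 ≤ c := by positivity
  have hPL : IsPicardLindelof (fun t x => B t (clamp c x)) (⟨0, left_mem_Icc.2 hT⟩ : Icc 0 T)
      x₀ (M * c * T).toNNReal 0 (M * c).toNNReal M.toNNReal := by
    constructor
    · intro t ht
      refine (LipschitzWith.of_dist_le_mul fun x y => ?_).lipschitzOnWith
      rw [Real.coe_toNNReal _ hM0, dist_eq_norm, ← map_sub]
      refine ((B t).le_opNorm _).trans ?_
      refine mul_le_mul (hM t ht) ?_ (norm_nonneg _) hM0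
      simpa [dist_eq_norm] using (lipschitzWith_clamp c).dist_le_mul x y
    · intro x _
      exact hB.clm_apply continuousOn_const
    · intro t ht x _
      rw [Real.coe_toNNReal _ (by positivity)]
      exact ((B t).le_opNorm _).trans
        (mul_le_mul (hM t ht) (norm_clamp_le hc0 x) (norm_nonneg _) hM0)
    · simp [Real.coe_toNNReal _ (show 0 ≤ M * c by positivity),
        Real.coe_toNNReal _ (show 0 ≤ M * c * T by positivity), hT]
  obtain ⟨u, hu0, hu⟩ := hPL.exists_eq_forall_mem_Icc_hasDerivWithinAt₀
  refine ⟨u, hu0, fun t ht => ?_⟩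
  -- Truncation does not increase the norm, so the truncated solution obeys the same Grönwall bound
  -- and the truncation is never active.
  have hbound : ‖u t‖ ≤ c := by
    have := norm_le_gronwallBound_of_norm_deriv_right_le (δ := ‖x₀‖) (K := M) (ε := 0)
      (fun s hs => (hu s hs).continuousWithinAt)
      (fun s hs => (hu s (Ico_subset_Icc_self hs)).mono_of_mem_nhdsWithin
        (Icc_mem_nhdsGE_of_mem hs)) (by simpa using (congrArg norm hu0).le)
      (fun s hs => by
        rw [add_zero]
        exact ((B s).le_opNorm _).trans (mul_le_mul (hM s (Ico_subset_Icc_self hs))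
          (norm_clamp_le_norm hc0 _) (norm_nonneg _) hM0)) t ht
    rw [gronwallBound_ε0, sub_zero] at this
    refine this.trans ?_
    rw [hc]
    have := ht.2
    gcongr
  simpa only [clamp_eq_self hbound] using hu t ht

/-- A linear terminal value problem `u' = -G u`, `u T = x₀` on `[0, T]` with continuous
coefficients has a solution on the whole interval. -/
theorem exists_hasDerivAt_mulVec {N : ℕ} {G : ℝ → Matrix (Fin N) (Fin N) ℝ}
    (hG : ∀ i j, Continuous fun t => G t i j) {T : ℝ} (hT : 0 ≤ T) (x₀ : Fin N → ℝ) :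
    ∃ u : ℝ → Fin N → ℝ, u T = x₀ ∧ ContinuousOn u (Icc 0 T) ∧
      ∀ t ∈ Ioo 0 T, ∀ i, HasDerivAt (fun s => u s i) (-∑ j, G t i j * u t j) t := by
  have hGc : Continuous G := continuous_matrix hG
  let Λ : Matrix (Fin N) (Fin N) ℝ →ₗ[ℝ] (Fin N → ℝ) →L[ℝ] (Fin N → ℝ) :=
    LinearMap.toContinuousLinearMap.toLinearMap ∘ₗ
      (Matrix.toLin' : Matrix (Fin N) (Fin N) ℝ ≃ₗ[ℝ] _).toLinearMap
  have hΛ : Continuous Λ := LinearMap.continuous_of_finiteDimensional Λ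
  -- Time reversal turns the terminal value problem into an initial value problem.
  have hB : Continuous fun t => Λ (G (T - t)) := hΛ.comp (hGc.comp (by fun_prop))
  obtain ⟨w, hw0, hw⟩ := exists_hasDerivWithinAt_linear hT hB.continuousOn x₀
  have hmaps : MapsTo (fun t => T - t) (Icc 0 T) (Icc 0 T) := fun t ht =>
    ⟨by linarith [ht.2], by linarith [ht.1]⟩
  refine ⟨fun t => w (T - t), by simpa using hw0, ?_, fun t ht i => ?_⟩
  · exact ContinuousOn.comp (fun t ht => (hw t ht).continuousWithinAt)
      (by fun_prop) hmaps
  · have h1 : HasDerivAt w (Λ (G (T - (T - t))) (w (T - t))) (T - t) :=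
      (hw (T - t) (hmaps (Ioo_subset_Icc_self ht))).hasDerivAt
        (Icc_mem_nhds (by linarith [ht.2]) (by linarith [ht.1]))
    have h2 := (hasDerivAt_pi.1 h1 i).comp_const_sub T t
    rw [sub_sub_cancel] at h2
    exact h2

end RegimeSwitching

/-! ### Transition probabilities and right derivatives of expectations -/

namespace RegimeSwitching

variable {N : ℕ} {Ω : Type*} [mΩ : MeasurableSpace Ω] {Q : Measure Ω}
  {𝓕 : Filtration ℝ≥0 mΩ} {X : ℝ≥0 → Ω → Fin N} {A : ℝ → Matrix (Fin N) (Fin N) ℝ}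

theorem IsMarkovChain.measurable (hX : IsMarkovChain Q 𝓕 X A) (t : ℝ≥0) : Measurable (X t) :=
  (hX.adapted t).mono (𝓕.le t) le_rfl

/-- Conditional expectation of `v (X s)` given the past up to time `t`, tested against an
`𝓕 t`-measurable random variable. -/
theorem IsMarkovChain.integral_mul_comp [IsProbabilityMeasure Q] (hX : IsMarkovChain Q 𝓕 X A)
    {t s : ℝ≥0} (hts : t ≤ s) {Z : Ω → ℝ} (hZ : AEStronglyMeasurable[𝓕 t] Z Q)
    (hZi : Integrable Z Q) (v : Fin N → ℝ) :
    ∫ ω, Z ω * v (X s ω) ∂Q =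
      ∑ k, (∫ ω in X t ⁻¹' {k}, Z ω ∂Q) * ∑ j, transProb Q X t s k j * v j := by
  have hms : ∀ j, MeasurableSet (X s ⁻¹' {j}) := fun j => hX.measurable s (measurableSet_singleton j)
  have hmt : ∀ j, MeasurableSet (X t ⁻¹' {j}) := fun j => hX.measurable t (measurableSet_singleton j)
  -- Condition on `𝓕 t`, pull `Z` out, apply the Markov property, and split according to the value
  -- of `X t`.
  have key : ∀ j, ∫ ω, Z ω * (X s ⁻¹' {j}).indicator (fun _ => (1 : ℝ)) ω ∂Q =
      ∑ k, (∫ ω in X t ⁻¹' {k}, Z ω ∂Q) * transProb Q X t s k j := by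
    intro j
    have hind : Integrable ((X s ⁻¹' {j}).indicator (fun _ => (1 : ℝ))) Q :=
      (integrable_const 1).indicator (hms j)
    have hprod : Integrable (Z * (X s ⁻¹' {j}).indicator (fun _ => (1 : ℝ))) Q := by
      refine hZi.mul_bdd (c := 1) hind.aestronglyMeasurable (ae_of_all _ fun ω => ?_)
      by_cases hω : ω ∈ X s ⁻¹' {j} <;> simp [indicator, hω]
    calc ∫ ω, Z ω * (X s ⁻¹' {j}).indicator (fun _ => (1 : ℝ)) ω ∂Q
        = ∫ ω, (Q[Z * (X s ⁻¹' {j}).indicator (fun _ => (1 : ℝ)) | 𝓕 t]) ω ∂Q :=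
          (integral_condExp (𝓕.le t)).symm
      _ = ∫ ω, Z ω * transProb Q X t s (X t ω) j ∂Q := by
          refine integral_congr_ae ?_
          filter_upwards [condExp_mul_of_aestronglyMeasurable_left hZ hprod hind,
            hX.markov t s hts j] with ω h1 h2
          rw [h1, Pi.mul_apply, h2]
      _ = ∫ ω, ∑ k, (X t ⁻¹' {k}).indicator Z ω * transProb Q X t s k j ∂Q := by
          refine integral_congr_ae (ae_of_all _ fun ω => ?_)
          simp only
          rw [Finset.sum_eq_single (X t ω)]
          · simp
          · intro k _ hk
            simp [indicator, hk.symm]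
          · simp
      _ = _ := by
          rw [integral_finsetSum _ fun k _ => (hZi.indicator (hmt k)).mul_const _]
          exact Finset.sum_congr rfl fun k _ => by
            rw [integral_mul_const, integral_indicator (hmt k)]
  calc ∫ ω, Z ω * v (X s ω) ∂Q
      = ∫ ω, ∑ j, Z ω * (X s ⁻¹' {j}).indicator (fun _ => (1 : ℝ)) ω * v j ∂Q := by
        refine integral_congr_ae (ae_of_all _ fun ω => ?_)
        simp only
        rw [Finset.sum_eq_single (X s ω)]
        · simp
        · intro k _ hk
          simp [indicator, hk.symm]
        · simp
    _ = ∑ j, (∑ k, (∫ ω in X t ⁻¹' {k}, Z ω ∂Q) * transProb Q X t s k j) * v j := by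
        rw [integral_finsetSum]
        · exact Finset.sum_congr rfl fun j _ => by rw [integral_mul_const, key]
        · intro j _
          refine Integrable.mul_const ?_ _
          refine hZi.mul_bdd (c := 1) (measurable_const.indicator (hms j)).aestronglyMeasurable
            (ae_of_all _ fun ω => ?_)
          by_cases hω : ω ∈ X s ⁻¹' {j} <;> simp [indicator, hω]
    _ = _ := by
        simp_rw [Finset.sum_mul, Finset.mul_sum]
        rw [Finset.sum_comm]
        simp_rw [mul_assoc]

theorem sum_transProb [IsProbabilityMeasure Q] (hX : ∀ t, Measurable (X t)) (t s : ℝ≥0)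
    {i : Fin N} (hi : Q (X t ⁻¹' {i}) ≠ 0) : ∑ j, transProb Q X t s i j = 1 := by
  have : IsProbabilityMeasure (Q[|X t ⁻¹' {i}]) := cond_isProbabilityMeasure hi
  simp only [transProb]
  rw [sum_measureReal_preimage_singleton _ fun j _ => hX s (measurableSet_singleton j)]
  simp

theorem transProb_self [IsProbabilityMeasure Q] (hX : ∀ t, Measurable (X t)) (t : ℝ≥0)
    {i : Fin N} (hi : Q (X t ⁻¹' {i}) ≠ 0) (j : Fin N) :
    transProb Q X t t i j = if j = i then 1 else 0 := by
  have hm := hX t (measurableSet_singleton i)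
  split_ifs with hij
  · subst hij
    rw [transProb, measureReal_def, cond_apply_self hi (measure_ne_top _ _)]
    simp
  · rw [transProb, measureReal_def, cond_apply hm]
    have : X t ⁻¹' {i} ∩ X t ⁻¹' {j} = ∅ := by
      ext ω
      simp only [mem_inter_iff, mem_preimage, mem_singleton_iff, mem_empty_iff_false, iff_false,
        not_and]
      rintro rfl rfl
      exact hij rfl
    simp [this]

theorem tendsto_sub_toNNReal (t : ℝ) :
    Tendsto (fun s : ℝ => (s - t).toNNReal) (𝓝[>] t) (𝓝[>] 0) := by
  refine tendsto_nhdsWithin_iff.2 ⟨?_, ?_⟩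
  · have : Continuous fun s : ℝ => (s - t).toNNReal := by fun_prop
    simpa using (this.tendsto t).mono_left nhdsWithin_le_nhds
  · filter_upwards [self_mem_nhdsWithin] with s hs
    simpa using hs

/-- The transition probabilities from time `t` have the generator as right derivative at `t`. -/
theorem IsMarkovChain.hasDerivWithinAt_transProb [IsProbabilityMeasure Q]
    (hX : IsMarkovChain Q 𝓕 X A) {t : ℝ} (ht : 0 ≤ t) {i : Fin N}
    (hi : Q (X t.toNNReal ⁻¹' {i}) ≠ 0) (j : Fin N) :
    HasDerivWithinAt (fun s : ℝ => transProb Q X t.toNNReal s.toNNReal i j) (A t i j)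
      (Ici t) t := by
  have hoff : ∀ j, i ≠ j → HasDerivWithinAt
      (fun s : ℝ => transProb Q X t.toNNReal s.toNNReal i j) (A t i j) (Ici t) t := by
    intro j hij
    rw [hasDerivWithinAt_iff_tendsto_slope, Ici_sdiff_left]
    have h := (hX.rate t.toNNReal i j hij hi).comp (tendsto_sub_toNNReal t)
    rw [Real.coe_toNNReal t ht] at h
    refine h.congr' ?_
    filter_upwards [self_mem_nhdsWithin] with s hs
    have hs' : 0 ≤ s - t := sub_nonneg.2 (le_of_lt hs)
    simp only [Function.comp_apply, slope_def_field]
    rw [transProb_self hX.measurable _ hi, if_neg (Ne.symm hij), sub_zero,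
      ← Real.toNNReal_add ht hs', add_sub_cancel, Real.coe_toNNReal _ hs']
  -- The diagonal entry follows from the others because each row of transition probabilities sums to
  -- one.
  by_cases hij : i = j
  · subst hij
    have hd := hX.rate_diag t.toNNReal i
    rw [Real.coe_toNNReal t ht] at hd
    rw [hd]
    have hs : ∀ s : ℝ≥0, transProb Q X t.toNNReal s i i =
        1 - ∑ j ∈ Finset.univ.erase i, transProb Q X t.toNNReal s i j := fun s => by
      rw [← sum_transProb hX.measurable t.toNNReal s hi,
        ← Finset.add_sum_erase _ _ (Finset.mem_univ i)]
      ring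
    simp_rw [hs]
    refine HasDerivWithinAt.const_sub 1 ?_
    exact HasDerivWithinAt.fun_sum fun j hj => hoff j (Finset.ne_of_mem_erase hj).symm
  · exact hoff j hij

/-- Right derivative of `s ↦ E[Z v(s, X_s)]` at `t` for an `𝓕 t`-measurable random variable `Z`. -/
theorem IsMarkovChain.hasDerivWithinAt_integral [IsProbabilityMeasure Q]
    (hX : IsMarkovChain Q 𝓕 X A) {t : ℝ} (ht : 0 ≤ t) {Z : Ω → ℝ}
    (hZ : AEStronglyMeasurable[𝓕 t.toNNReal] Z Q) (hZi : Integrable Z Q)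
    {v : ℝ → Fin N → ℝ} {v' : Fin N → ℝ}
    (hv : ∀ k, HasDerivWithinAt (fun s => v s k) (v' k) (Ici t) t) :
    HasDerivWithinAt (fun s : ℝ => ∫ ω, Z ω * v s (X s.toNNReal ω) ∂Q)
      (∑ k, (∫ ω in X t.toNNReal ⁻¹' {k}, Z ω ∂Q) * (∑ j, A t k j * v t j + v' k))
      (Ici t) t := by
  have hrep : ∀ s ∈ Ici t, ∫ ω, Z ω * v s (X s.toNNReal ω) ∂Q =
      ∑ k, (∫ ω in X t.toNNReal ⁻¹' {k}, Z ω ∂Q) *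
        ∑ j, transProb Q X t.toNNReal s.toNNReal k j * v s j := fun s hs =>
    hX.integral_mul_comp (Real.toNNReal_le_toNNReal hs) hZ hZi (v s)
  refine HasDerivWithinAt.congr ?_ hrep (hrep t self_mem_Ici)
  refine HasDerivWithinAt.fun_sum fun k _ => ?_
  -- The generator says nothing about a null state, but such a state carries weight zero.
  by_cases hk : Q (X t.toNNReal ⁻¹' {k}) = 0
  · simp only [setIntegral_measure_zero _ hk, zero_mul]
    exact hasDerivWithinAt_const _ _ _
  · refine HasDerivWithinAt.const_mul _ ?_
    have h := HasDerivWithinAt.fun_sum (u := Finset.univ) fun j _ =>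
      (hX.hasDerivWithinAt_transProb ht hk j).mul (hv j)
    refine h.congr_deriv ?_
    simp [Finset.sum_add_distrib, transProb_self hX.measurable _ hk]

end RegimeSwitching

/-! ### Path regularity and measurability of running integrals -/

namespace RegimeSwitching

variable {N : ℕ} {Ω : Type*} [mΩ : MeasurableSpace Ω] {Q : Measure Ω}
  {𝓕 : Filtration ℝ≥0 mΩ} {X : ℝ≥0 → Ω → Fin N} {A : ℝ → Matrix (Fin N) (Fin N) ℝ}

/-- A path, run in real time, is locally constant to the right of every time. -/
def LocallyConstantRight (x : ℝ → Fin N) : Prop := ∀ t, ∀ᶠ s in 𝓝[≥] t, x s = x t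

theorem IsMarkovChain.ae_locallyConstantRight (hX : IsMarkovChain Q 𝓕 X A) :
    ∀ᵐ ω ∂Q, LocallyConstantRight fun s : ℝ => X s.toNNReal ω := by
  filter_upwards [hX.right_continuous] with ω hω t
  have h := hω t.toNNReal
  rw [ContinuousWithinAt, nhds_discrete, tendsto_pure] at h
  refine Tendsto.eventually (tendsto_nhdsWithin_iff.2 ⟨?_, ?_⟩) h
  · exact (continuous_real_toNNReal.tendsto t).mono_left nhdsWithin_le_nhds
  · filter_upwards [self_mem_nhdsWithin] with s hs
    exact Real.toNNReal_le_toNNReal hs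

/-- Right-continuity controls one side and the absence of a jump at the fixed time `t` the other.
The exceptional null set depends on `t`. -/
theorem IsMarkovChain.ae_eventually_eq (hX : IsMarkovChain Q 𝓕 X A) {t : ℝ} (ht : 0 < t) :
    ∀ᵐ ω ∂Q, ∀ᶠ s in 𝓝 t, X s.toNNReal ω = X t.toNNReal ω := by
  filter_upwards [hX.ae_locallyConstantRight,
    hX.no_fixed_jump t.toNNReal (Real.toNNReal_pos.2 ht)] with ω h1 h2
  rw [nhds_discrete, tendsto_pure] at h2
  rw [← nhdsLT_sup_nhdsGE, eventually_sup]
  refine ⟨Tendsto.eventually (tendsto_nhdsWithin_iff.2 ⟨?_, ?_⟩) h2, h1 t⟩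
  · exact (continuous_real_toNNReal.tendsto t).mono_left nhdsWithin_le_nhds
  · filter_upwards [self_mem_nhdsWithin] with s hs
    exact (Real.toNNReal_lt_toNNReal_iff ht).2 hs

/-- The point of the grid of mesh `1 / (n + 1)` that follows `u`. -/
noncomputable def gridAfter (n : ℕ) (u : ℝ) : ℝ := (⌊(n + 1 : ℝ) * u⌋ + 1 : ℝ) / (n + 1)

theorem lt_gridAfter (n : ℕ) (u : ℝ) : u < gridAfter n u := by
  rw [gridAfter, lt_div_iff₀ (by positivity), mul_comm]
  exact Int.lt_floor_add_one _

theorem gridAfter_le (n : ℕ) (u : ℝ) : gridAfter n u ≤ u + 1 / ((n : ℝ) + 1) := by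
  have hn : (n : ℝ) + 1 ≠ 0 := by positivity
  rw [gridAfter, div_le_iff₀ (by positivity), add_mul u, one_div, inv_mul_cancel₀ hn, mul_comm u]
  linarith [Int.floor_le ((n + 1 : ℝ) * u)]

theorem tendsto_gridAfter (u : ℝ) : Tendsto (fun n => gridAfter n u) atTop (𝓝[>] u) := by
  refine tendsto_nhdsWithin_iff.2 ⟨?_, Eventually.of_forall fun n => lt_gridAfter n u⟩
  refine tendsto_of_tendsto_of_tendsto_of_le_of_le tendsto_const_nhds ?_
    (fun n => (lt_gridAfter n u).le) (fun n => gridAfter_le n u)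
  simpa using tendsto_one_div_add_atTop_nhds_zero_nat.const_add u

theorem LocallyConstantRight.eventually_gridAfter {x : ℝ → Fin N} (hx : LocallyConstantRight x)
    (u : ℝ) : ∀ᶠ n in atTop, x (gridAfter n u) = x u :=
  (tendsto_gridAfter u).eventually ((hx u).filter_mono (nhdsWithin_mono _ Ioi_subset_Ici_self))

/-- Sampling at the next grid point gives functions that factor through a floor, hence through the
countable set `ℤ`; they converge pointwise by right-continuity. -/
theorem LocallyConstantRight.measurable {x : ℝ → Fin N} (hx : LocallyConstantRight x)
    (R : Fin N → ℝ) : Measurable fun u => R (x u) := by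
  refine measurable_of_tendsto_metrizable (f := fun n u => R (x (gridAfter n u))) (fun n => ?_) ?_
  · have : (fun u => R (x (gridAfter n u))) =
      (fun k : ℤ => R (x ((k + 1 : ℝ) / (n + 1)))) ∘ fun u : ℝ => ⌊(n + 1 : ℝ) * u⌋ := rfl
    rw [this]
    exact (measurable_of_countable _).comp (Int.measurable_floor.comp (measurable_const_mul _))
  · rw [tendsto_pi_nhds]
    intro u
    refine tendsto_const_nhds.congr' ?_
    filter_upwards [hx.eventually_gridAfter u] with n hn
    rw [hn]

theorem LocallyConstantRight.intervalIntegrable {x : ℝ → Fin N} (hx : LocallyConstantRight x)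
    (R : Fin N → ℝ) (a b : ℝ) : IntervalIntegrable (fun u => R (x u)) volume a b := by
  obtain ⟨C, hC⟩ := (finite_range R).isBounded.exists_norm_le
  refine (intervalIntegrable_const (c := C)).mono_fun (hx.measurable R).aestronglyMeasurable
    (ae_of_all _ fun u => ?_)
  exact (hC _ (mem_range_self _)).trans (le_abs_self C)

theorem stronglyMeasurable_integral_floor {Ω : Type*} [MeasurableSpace Ω] {Y : ℤ → Ω → ℝ}
    (hY : ∀ k, Measurable (Y k)) (c : ℝ) {a b : ℝ} (hab : a ≤ b) :
    StronglyMeasurable fun ω => ∫ u in a..b, Y ⌊c * u⌋ ω := by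
  simp_rw [intervalIntegral.integral_of_le hab]
  refine StronglyMeasurable.integral_prod_right (f := fun ω u => Y ⌊c * u⌋ ω) ?_
  have hk : Measurable fun p : Ω × ℤ => Y p.2 p.1 := measurable_from_prod_countable_left hY
  exact (hk.comp (measurable_fst.prodMk (Int.measurable_floor.comp
    ((measurable_const_mul c).comp measurable_snd)))).stronglyMeasurable

/-- The running integral of a function of the chain is adapted, up to null sets. -/
theorem IsMarkovChain.aestronglyMeasurable_integral (hX : IsMarkovChain Q 𝓕 X A)
    (R : Fin N → ℝ) {a t : ℝ} (hat : a ≤ t) :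
    AEStronglyMeasurable[𝓕 t.toNNReal]
      (fun ω => ∫ u in a..t, R (X u.toNNReal ω)) Q := by
  obtain ⟨C, hC⟩ := (finite_range R).isBounded.exists_norm_le
  have hcell : ∀ (n : ℕ) (ω : Ω), Measurable fun u => R (X (min (gridAfter n u) t).toNNReal ω) := by
    intro n ω
    exact (measurable_of_countable fun k : ℤ =>
      R (X (min ((k + 1 : ℝ) / (n + 1)) t).toNNReal ω)).comp
        (Int.measurable_floor.comp (measurable_const_mul (n + 1 : ℝ)))
  -- The cap at `t` keeps the sampled times from looking past `t`, which makes the approximations `𝓕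
  -- t`-measurable.
  have hmeas : ∀ n : ℕ, StronglyMeasurable[𝓕 t.toNNReal]
      fun ω => ∫ u in a..t, R (X (min (gridAfter n u) t).toNNReal ω) := by
    intro n
    refine @stronglyMeasurable_integral_floor _ (𝓕 t.toNNReal)
      (fun k ω => R (X (min ((k + 1 : ℝ) / (n + 1)) t).toNNReal ω)) (fun k => ?_) (n + 1) a t hat
    exact (measurable_of_countable R).comp ((hX.adapted _).mono
      (𝓕.mono (Real.toNNReal_le_toNNReal (min_le_right _ _))) le_rfl)
  -- The limsup is `𝓕 t`-measurable whether or not the limit exists, so the bad null set need not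
  -- belong to `𝓕 t`.
  refine ⟨_, (Measurable.limsup fun n => (hmeas n).measurable).stronglyMeasurable, ?_⟩
  filter_upwards [hX.ae_locallyConstantRight] with ω hω
  refine (Tendsto.limsup_eq ?_).symm
  refine intervalIntegral.tendsto_integral_filter_of_dominated_convergence (fun _ => C)
    (Eventually.of_forall fun n => (hcell n ω).aestronglyMeasurable)
    (Eventually.of_forall fun n => ae_of_all _ fun u _ => hC _ (mem_range_self _))
    intervalIntegrable_const ?_
  filter_upwards [compl_mem_ae_iff.2 (measure_singleton t)] with u hut hu
  rw [uIoc_of_le hat] at hu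
  have hlt : u < t := lt_of_le_of_ne hu.2 hut
  refine tendsto_const_nhds.congr' ?_
  filter_upwards [hω.eventually_gridAfter u, (tendsto_gridAfter u).eventually
    (mem_nhdsWithin_of_mem_nhds (Iio_mem_nhds hlt))] with n hn hn'
  rw [min_eq_left (le_of_lt hn'), hn]

end RegimeSwitching

/-! ### One-dimensional laws and positivity of the state probabilities -/

namespace RegimeSwitching

variable {N : ℕ} {Ω : Type*} [mΩ : MeasurableSpace Ω] {Q : Measure Ω}
  {𝓕 : Filtration ℝ≥0 mΩ} {X : ℝ≥0 → Ω → Fin N} {A : ℝ → Matrix (Fin N) (Fin N) ℝ}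

theorem IsMarkovChain.ae_eventually_eq_nhdsWithin (hX : IsMarkovChain Q 𝓕 X A) {t : ℝ}
    (ht : 0 ≤ t) : ∀ᵐ ω ∂Q, ∀ᶠ s in 𝓝[Ici 0] t, X s.toNNReal ω = X t.toNNReal ω := by
  rcases ht.eq_or_lt with rfl | ht
  · filter_upwards [hX.ae_locallyConstantRight] with ω hω using hω 0
  · filter_upwards [hX.ae_eventually_eq ht] with ω hω using hω.filter_mono nhdsWithin_le_nhds

theorem measureReal_preimage_eq_integral (hX : ∀ t, Measurable (X t)) (t : ℝ≥0) (j : Fin N) :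
    Q.real (X t ⁻¹' {j}) = ∫ ω, (1 : ℝ) * (Pi.single j (1 : ℝ) : Fin N → ℝ) (X t ω) ∂Q := by
  rw [← integral_indicator_one (hX t (measurableSet_singleton j))]
  refine integral_congr_ae (ae_of_all _ fun ω => ?_)
  by_cases h : X t ω = j <;> simp [h]

theorem IsMarkovChain.continuousOn_measureReal [IsProbabilityMeasure Q]
    (hX : IsMarkovChain Q 𝓕 X A) (j : Fin N) :
    ContinuousOn (fun t : ℝ => Q.real (X t.toNNReal ⁻¹' {j})) (Ici 0) := by
  simp_rw [measureReal_preimage_eq_integral hX.measurable, one_mul]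
  intro t ht
  refine continuousWithinAt_of_dominated (bound := fun _ => 1)
    (Eventually.of_forall fun s =>
      ((measurable_of_countable _).comp (hX.measurable _)).aestronglyMeasurable)
    (Eventually.of_forall fun s => ae_of_all _ fun ω => ?_) (integrable_const _) ?_
  · by_cases h : X s.toNNReal ω = j <;> simp [h]
  · filter_upwards [hX.ae_eventually_eq_nhdsWithin ht] with ω hω
    refine tendsto_const_nhds.congr' ?_
    filter_upwards [hω] with s hs
    rw [hs]

/-- Forward equation for the one-dimensional laws of the chain. -/
theorem IsMarkovChain.hasDerivWithinAt_measureReal [IsProbabilityMeasure Q]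
    (hX : IsMarkovChain Q 𝓕 X A) {t : ℝ} (ht : 0 ≤ t) (j : Fin N) :
    HasDerivWithinAt (fun s : ℝ => Q.real (X s.toNNReal ⁻¹' {j}))
      (∑ k, Q.real (X t.toNNReal ⁻¹' {k}) * A t k j) (Ici t) t := by
  simp_rw [measureReal_preimage_eq_integral hX.measurable _ j]
  have h := hX.hasDerivWithinAt_integral ht (Z := fun _ => 1) aestronglyMeasurable_const
    (integrable_const 1) (v := fun _ => Pi.single j 1) (v' := 0)
    fun k => hasDerivWithinAt_const _ _ _
  refine h.congr_deriv ?_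
  simp [Pi.single_apply]

/-- If all off-diagonal rates are bounded, `e^{Ct} Q(X_t = e_j)` is nondecreasing. -/
theorem IsMarkovChain.exp_mul_measureReal_le [IsProbabilityMeasure Q]
    (hX : IsMarkovChain Q 𝓕 X A) {T C : ℝ} {j : Fin N} (hC : ∀ s ∈ Icc 0 T, -C ≤ A s j j)
    {t : ℝ} (htT : t ≤ T) {s : ℝ} (hs0 : 0 ≤ s) (hst : s ≤ t) :
    Real.exp (C * s) * Q.real (X s.toNNReal ⁻¹' {j}) ≤
      Real.exp (C * t) * Q.real (X t.toNNReal ⁻¹' {j}) := by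
  have hexp : ∀ x : ℝ, HasDerivAt (fun y => Real.exp (C * y)) (Real.exp (C * x) * C) x := fun x => by
    simpa using ((hasDerivAt_id x).const_mul C).exp
  -- Compare with the constant value at `s`; only right derivatives are available, so continuity on
  -- `[s, t]` is supplied separately.
  have h := image_le_of_deriv_right_le_deriv_boundary (a := s) (b := t)
    (f := fun _ => Real.exp (C * s) * Q.real (X s.toNNReal ⁻¹' {j})) (f' := fun _ => 0)
    (B := fun x => Real.exp (C * x) * Q.real (X x.toNNReal ⁻¹' {j}))
    continuousOn_const (fun x _ => hasDerivWithinAt_const _ _ _) le_rfl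
    (ContinuousOn.mul (by fun_prop)
      ((hX.continuousOn_measureReal j).mono fun x hx => hs0.trans hx.1))
    (fun x hx => (hexp x).hasDerivWithinAt.mul
      (hX.hasDerivWithinAt_measureReal (hs0.trans hx.1) j))
    (fun x hx => ?_)
  · exact h (right_mem_Icc.2 hst)
  · have hx0 : 0 ≤ x := hs0.trans hx.1
    -- Discarding the nonnegative inflow from the other states leaves only the outflow, which the
    -- factor `e^{Cx}` compensates.
    have hsum : Q.real (X x.toNNReal ⁻¹' {j}) * A x j j ≤
        ∑ k, Q.real (X x.toNNReal ⁻¹' {k}) * A x k j := by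
      rw [← Finset.add_sum_erase _ _ (Finset.mem_univ j)]
      refine le_add_of_nonneg_right (Finset.sum_nonneg fun k hk => ?_)
      have := hX.rate_nonneg x.toNNReal k j (Finset.ne_of_mem_erase hk)
      rw [Real.coe_toNNReal x hx0] at this
      positivity
    have h1 := hC x ⟨hx0, hx.2.le.trans htT⟩
    have h2 : 0 ≤ Q.real (X x.toNNReal ⁻¹' {j}) := measureReal_nonneg
    have h3 : 0 < Real.exp (C * x) := Real.exp_pos _
    have h4 : 0 ≤ C * Q.real (X x.toNNReal ⁻¹' {j}) +
        ∑ k, Q.real (X x.toNNReal ⁻¹' {k}) * A x k j := by nlinarith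
    have := mul_nonneg h3.le h4
    linarith

/-- A chain with bounded rates that are all positive at time `0` charges every regime at every
later time. -/
theorem IsMarkovChain.measure_preimage_pos [IsProbabilityMeasure Q]
    (hX : IsMarkovChain Q 𝓕 X A) {T C : ℝ} {j : Fin N} (hC : ∀ s ∈ Icc 0 T, -C ≤ A s j j)
    (hpos : ∀ k, k ≠ j → 0 < A 0 k j) {t : ℝ} (ht : 0 < t) (htT : t ≤ T) :
    0 < Q (X t.toNNReal ⁻¹' {j}) := by
  by_contra hcon
  have hzero : Q.real (X t.toNNReal ⁻¹' {j}) = 0 := by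
    rw [measureReal_def, nonpos_iff_eq_zero.1 (not_lt.1 hcon), ENNReal.toReal_zero]
  have hz : ∀ s ∈ Icc 0 t, Q.real (X s.toNNReal ⁻¹' {j}) = 0 := by
    intro s hs
    have h := hX.exp_mul_measureReal_le hC htT hs.1 hs.2
    rw [hzero, mul_zero] at h
    exact le_antisymm (nonpos_of_mul_nonpos_right h (Real.exp_pos _)) measureReal_nonneg
  -- The mass of `j` vanishes on `[0, t]`, so its right derivative at `0`, computed by the forward
  -- equation, is zero.
  have hd : ∑ k, Q.real (X (0 : ℝ).toNNReal ⁻¹' {k}) * A 0 k j = 0 := by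
    refine (uniqueDiffWithinAt_Ici (0 : ℝ)).eq_deriv _ (hX.hasDerivWithinAt_measureReal le_rfl j) ?_
    refine (hasDerivWithinAt_const (0 : ℝ) (Ici 0) (0 : ℝ)).congr_of_eventuallyEq ?_
      (hz 0 (left_mem_Icc.2 ht.le))
    filter_upwards [Icc_mem_nhdsGE ht] with s hs using hz s hs
  have hnn : ∀ k ∈ Finset.univ, 0 ≤ Q.real (X (0 : ℝ).toNNReal ⁻¹' {k}) * A 0 k j := by
    intro k _
    by_cases hk : k = j
    · rw [hk, hz 0 (left_mem_Icc.2 ht.le), zero_mul]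
    · exact mul_nonneg measureReal_nonneg (hpos k hk).le
  have hall : ∀ k, Q.real (X (0 : ℝ).toNNReal ⁻¹' {k}) = 0 := by
    intro k
    by_cases hk : k = j
    · rw [hk, hz 0 (left_mem_Icc.2 ht.le)]
    · exact (mul_eq_zero.1 ((Finset.sum_eq_zero_iff_of_nonneg hnn).1 hd k (Finset.mem_univ k))
        ).resolve_right (hpos k hk).ne'
  have hone : ∑ k, Q.real (X (0 : ℝ).toNNReal ⁻¹' {k}) = 1 := by
    rw [sum_measureReal_preimage_singleton _ fun k _ =>
      hX.measurable _ (measurableSet_singleton k)]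
    simp
  rw [Finset.sum_eq_zero fun k _ => hall k] at hone
  exact zero_ne_one hone

end RegimeSwitching

/-! ### Discount factors and the Feynman–Kac formula -/

namespace RegimeSwitching

variable {N : ℕ} {Ω : Type*} {X : ℝ≥0 → Ω → Fin N}

/-- The discount factor `exp(-∫_a^s R(X_u) du)`. -/
noncomputable def discount (X : ℝ≥0 → Ω → Fin N) (R : Fin N → ℝ) (a s : ℝ) (ω : Ω) : ℝ :=
  Real.exp (-∫ u in a..s, R (X u.toNNReal ω))

theorem discountedPayoff_eq (r h L Ξ : Fin N → ℝ) (T t : ℝ) (ω : Ω) :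
    discountedPayoff X r h L Ξ T t ω =
      Ξ (X T.toNNReal ω) * discount X (fun i => r i + h i * L i) t T ω := rfl

theorem discount_le_one {R : Fin N → ℝ} (hR : ∀ i, 0 ≤ R i) {a s : ℝ} (has : a ≤ s) (ω : Ω) :
    discount X R a s ω ≤ 1 := by
  rw [discount, Real.exp_le_one_iff, neg_nonpos]
  exact intervalIntegral.integral_nonneg has fun u _ => hR _

theorem hasDerivWithinAt_discount {ω : Ω}
    (hω : LocallyConstantRight fun s : ℝ => X s.toNNReal ω) (R : Fin N → ℝ) (a t : ℝ) :
    HasDerivWithinAt (fun s => discount X R a s ω)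
      (-R (X t.toNNReal ω) * discount X R a t ω) (Ici t) t := by
  have hc : ContinuousWithinAt (fun s : ℝ => R (X s.toNNReal ω)) (Ioi t) t := by
    refine tendsto_const_nhds.congr' ?_
    filter_upwards [(hω t).filter_mono (nhdsWithin_mono _ Ioi_subset_Ici_self)] with s hs
    rw [hs]
  have h := intervalIntegral.integral_hasDerivWithinAt_right (s := Ici t)
    (hω.intervalIntegrable R a t)
    ((hω.measurable R).stronglyMeasurable.stronglyMeasurableAtFilter) hc
  exact h.neg.exp.congr_deriv (mul_comm _ _)

theorem continuous_discount {ω : Ω}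
    (hω : LocallyConstantRight fun s : ℝ => X s.toNNReal ω) (R : Fin N → ℝ) (a : ℝ) :
    Continuous fun s => discount X R a s ω :=
  Real.continuous_exp.comp
    (intervalIntegral.continuous_primitive (fun b c => hω.intervalIntegrable R b c) a).neg

/-- The discount factor is multiplicative over adjacent intervals, and `1 - e^{-I} ≤ I`. This
uniform bound dominates the difference quotients in `feynmanKac`. -/
theorem abs_discount_sub_le {ω : Ω}
    (hω : LocallyConstantRight fun s : ℝ => X s.toNNReal ω) {R : Fin N → ℝ} (hR : ∀ i, 0 ≤ R i)
    {C : ℝ} (hC : ∀ i, R i ≤ C) {a t s : ℝ} (hat : a ≤ t) (hts : t ≤ s) :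
    |discount X R a s ω - discount X R a t ω| ≤ C * (s - t) := by
  set I : ℝ := ∫ u in t..s, R (X u.toNNReal ω) with hI
  have hI0 : 0 ≤ I := intervalIntegral.integral_nonneg hts fun u _ => hR _
  have hIC : I ≤ C * (s - t) := by
    have := intervalIntegral.integral_mono_on hts (hω.intervalIntegrable R t s)
      (intervalIntegrable_const (c := C)) fun u _ => hC _
    rwa [intervalIntegral.integral_const, smul_eq_mul, mul_comm] at this
  have hmul : discount X R a s ω = discount X R a t ω * Real.exp (-I) := by
    rw [discount, discount, ← Real.exp_add, ← neg_add, hI,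
      intervalIntegral.integral_add_adjacent_intervals (hω.intervalIntegrable R a t)
        (hω.intervalIntegrable R t s)]
  have h0 : 0 < discount X R a t ω := Real.exp_pos _
  have h1 : discount X R a t ω ≤ 1 := discount_le_one hR hat ω
  have h2 : Real.exp (-I) ≤ 1 := by simpa using hI0
  have h3 := Real.add_one_le_exp (-I)
  rw [hmul, abs_le]
  constructor <;> nlinarith

variable [mΩ : MeasurableSpace Ω] {Q : Measure Ω} {𝓕 : Filtration ℝ≥0 mΩ}
  {A : ℝ → Matrix (Fin N) (Fin N) ℝ}

theorem IsMarkovChain.aestronglyMeasurable_discount (hX : IsMarkovChain Q 𝓕 X A)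
    (R : Fin N → ℝ) {a s : ℝ} (has : a ≤ s) :
    AEStronglyMeasurable[𝓕 s.toNNReal] (discount X R a s) Q :=
  Real.continuous_exp.comp_aestronglyMeasurable (hX.aestronglyMeasurable_integral R has).neg

theorem IsMarkovChain.integral_mul_comp_self [IsProbabilityMeasure Q]
    (hX : IsMarkovChain Q 𝓕 X A) {t : ℝ≥0} {Z : Ω → ℝ} (hZ : AEStronglyMeasurable[𝓕 t] Z Q)
    (hZi : Integrable Z Q) (v : Fin N → ℝ) :
    ∫ ω, Z ω * v (X t ω) ∂Q = ∑ k, (∫ ω in X t ⁻¹' {k}, Z ω ∂Q) * v k := by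
  rw [hX.integral_mul_comp le_rfl hZ hZi]
  refine Finset.sum_congr rfl fun k _ => ?_
  by_cases hk : Q (X t ⁻¹' {k}) = 0
  · simp only [setIntegral_measure_zero _ hk, zero_mul]
  · simp [transProb_self hX.measurable _ hk]

/-- **Feynman–Kac formula**: a solution of the backward equation `u' = R u - A u` is the
discounted conditional expectation of its terminal value. -/
theorem IsMarkovChain.feynmanKac [IsProbabilityMeasure Q] (hX : IsMarkovChain Q 𝓕 X A)
    {R : Fin N → ℝ} (hR : ∀ i, 0 ≤ R i) {a T : ℝ} (ha : 0 ≤ a) (haT : a ≤ T)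
    {u : ℝ → Fin N → ℝ} (hu : ContinuousOn u (Icc a T))
    (hu' : ∀ t ∈ Ico a T, ∀ k, HasDerivWithinAt (fun s => u s k)
      (R k * u t k - ∑ j, A t k j * u t j) (Ici t) t) (i : Fin N) :
    ∫ ω in X a.toNNReal ⁻¹' {i}, u T (X T.toNNReal ω) * discount X R a T ω ∂Q =
      Q.real (X a.toNNReal ⁻¹' {i}) * u a i := by
  obtain ⟨C, hC⟩ : ∃ C, ∀ k, R k ≤ C := by
    obtain ⟨C, hC⟩ := (finite_range R).bddAbove
    exact ⟨C, fun k => hC (mem_range_self k)⟩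
  obtain ⟨U, hU⟩ := isCompact_Icc.exists_bound_of_continuousOn hu
  have hUk : ∀ s ∈ Icc a T, ∀ k, ‖u s k‖ ≤ U := fun s hs k => (norm_le_pi_norm _ k).trans (hU s hs)
  have huk : ∀ k, ContinuousOn (fun s => u s k) (Icc a T) := fun k => continuousOn_pi.1 hu k
  set S : Set Ω := X a.toNNReal ⁻¹' {i} with hS
  have hSm : MeasurableSet S := hX.measurable _ (measurableSet_singleton i)
  set Z : ℝ → Ω → ℝ := fun s => S.indicator (discount X R a s) with hZdef
  have hZF : ∀ s, a ≤ s → AEStronglyMeasurable[𝓕 s.toNNReal] (Z s) Q := fun s hs => by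
    obtain ⟨D, hD, hDe⟩ := hX.aestronglyMeasurable_discount R hs
    refine ⟨S.indicator D, hD.indicator (𝓕.mono (Real.toNNReal_le_toNNReal hs) _
      (hX.adapted a.toNNReal (measurableSet_singleton i))), ?_⟩
    filter_upwards [hDe] with ω hω
    simp only [hZdef, indicator, hω]
  have hZm : ∀ s, a ≤ s → AEStronglyMeasurable (Z s) Q := fun s hs => (hZF s hs).mono (𝓕.le _)
  have hZ1 : ∀ s, a ≤ s → ∀ ω, ‖Z s ω‖ ≤ 1 := fun s hs ω => by
    refine (norm_indicator_le_norm_self _ _).trans ?_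
    rw [discount, Real.norm_eq_abs, Real.abs_exp]
    exact discount_le_one hR hs ω
  have hZi : ∀ s, a ≤ s → Integrable (Z s) Q := fun s hs =>
    (integrable_const (1 : ℝ)).mono' (hZm s hs) (ae_of_all _ (hZ1 s hs))
  have hZsub : ∀ t s, a ≤ t → t ≤ s → ∀ᵐ ω ∂Q, |Z s ω - Z t ω| ≤ C * (s - t) := by
    intro t s hat hts
    filter_upwards [hX.ae_locallyConstantRight] with ω hω
    have := abs_discount_sub_le hω hR hC hat hts
    by_cases hωS : ω ∈ S
    · simpa [hZdef, hωS] using this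
    · simpa [hZdef, hωS] using (abs_nonneg _).trans this
  have hum : ∀ s t : ℝ, AEStronglyMeasurable (fun ω => u s (X t.toNNReal ω)) Q := fun s t =>
    ((measurable_of_countable (u s)).comp (hX.measurable _)).aestronglyMeasurable
  set g : ℝ → ℝ := fun s => ∫ ω, Z s ω * u s (X s.toNNReal ω) ∂Q with hg
  -- Right derivatives do not control `g` from the left; here the absence of fixed jumps is needed.
  have hgc : ContinuousOn g (Icc a T) := by
    intro t ht
    refine continuousWithinAt_of_dominated (bound := fun _ => 1 * U) ?_ ?_ (integrable_const _) ?_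
    · filter_upwards [self_mem_nhdsWithin] with s hs using (hZm s hs.1).mul (hum s s)
    · filter_upwards [self_mem_nhdsWithin] with s hs
      refine ae_of_all _ fun ω => ?_
      rw [norm_mul]
      exact mul_le_mul (hZ1 s hs.1 ω) (hUk s hs _) (norm_nonneg _) zero_le_one
    · filter_upwards [hX.ae_locallyConstantRight,
        hX.ae_eventually_eq_nhdsWithin (ha.trans ht.1)] with ω h1 h2
      have hsub : 𝓝[Icc a T] t ≤ 𝓝[Ici 0] t := nhdsWithin_mono _ fun s hs => ha.trans hs.1
      have hZc : ContinuousWithinAt (fun s => Z s ω) (Icc a T) t := by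
        by_cases hωS : ω ∈ S
        · simpa [hZdef, hωS] using (continuous_discount h1 R a).continuousWithinAt
        · simpa [hZdef, hωS] using continuousWithinAt_const
      refine (hZc.mul (huk (X t.toNNReal ω) t ht)).congr_of_eventuallyEq ?_ rfl
      filter_upwards [hsub h2] with s hs
      rw [hs]
      rfl
  have hgd : ∀ t ∈ Ico a T, HasDerivWithinAt g 0 (Ici t) t := by
    intro t ht
    have ht0 : 0 ≤ t := ha.trans ht.1
    -- Split `Z s = Z t + (Z s - Z t)`: the frozen part is differentiated through the generator, the
    -- increment by dominated convergence.
    have h1 := hX.hasDerivWithinAt_integral ht0 (hZF t ht.1) (hZi t ht.1) (hu' t ht)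
    have h2 : HasDerivWithinAt (fun s => ∫ ω, (Z s ω - Z t ω) * u s (X s.toNNReal ω) ∂Q)
        (∫ ω, Z t ω * (-R (X t.toNNReal ω) * u t (X t.toNNReal ω)) ∂Q) (Ici t) t := by
      rw [hasDerivWithinAt_iff_tendsto_slope, Ici_sdiff_left]
      have hev : ∀ᶠ s in 𝓝[>] t, s ∈ Ioo t T := Ioo_mem_nhdsGT ht.2
      have hlim : Tendsto
          (fun s => ∫ ω, slope (fun s => Z s ω) t s * u s (X s.toNNReal ω) ∂Q) (𝓝[>] t)
          (𝓝 (∫ ω, Z t ω * (-R (X t.toNNReal ω) * u t (X t.toNNReal ω)) ∂Q)) := by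
        refine tendsto_integral_filter_of_dominated_convergence (fun _ => C * U) ?_ ?_
          (integrable_const _) ?_
        · filter_upwards [hev] with s hs
          simp_rw [slope_def_field, div_eq_inv_mul]
          have hsub : AEStronglyMeasurable (fun ω => Z s ω - Z t ω) Q :=
            (hZm s (ht.1.trans hs.1.le)).sub (hZm t ht.1)
          exact (hsub.const_mul _).mul (hum s s)
        · filter_upwards [hev] with s hs
          filter_upwards [hZsub t s ht.1 hs.1.le] with ω hω
          have hst : 0 < s - t := sub_pos.2 hs.1
          have hsl : |slope (fun s => Z s ω) t s| ≤ C := by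
            rw [slope_def_field, abs_div, abs_of_pos hst, div_le_iff₀ hst]
            exact hω
          rw [norm_mul]
          exact mul_le_mul hsl (hUk s ⟨ht.1.trans hs.1.le, hs.2.le⟩ _) (norm_nonneg _)
            ((abs_nonneg _).trans hsl)
        · filter_upwards [hX.ae_locallyConstantRight] with ω hω
          have hZd : HasDerivWithinAt (fun s => Z s ω) (Z t ω * -R (X t.toNNReal ω)) (Ici t) t := by
            by_cases hωS : ω ∈ S
            · simpa [hZdef, hωS, mul_comm] using hasDerivWithinAt_discount hω R a t
            · simpa [hZdef, hωS] using hasDerivWithinAt_const t (Ici t) (0 : ℝ)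
          rw [hasDerivWithinAt_iff_tendsto_slope, Ici_sdiff_left] at hZd
          have huc : Tendsto (fun s => u s (X t.toNNReal ω)) (𝓝[>] t)
              (𝓝 (u t (X t.toNNReal ω))) :=
            (hu' t ht _).continuousWithinAt.mono_left (nhdsWithin_mono _ Ioi_subset_Ici_self)
          have := hZd.mul huc
          rw [mul_assoc] at this
          refine this.congr' ?_
          filter_upwards [(hω t).filter_mono (nhdsWithin_mono _ Ioi_subset_Ici_self)] with s hs
          rw [hs]
      refine hlim.congr' ?_
      filter_upwards [hev] with s hs
      rw [slope_def_field]
      simp only [sub_self, zero_mul, integral_zero, sub_zero]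
      rw [← integral_div]
      refine integral_congr_ae (ae_of_all _ fun ω => ?_)
      simp only [slope_def_field]
      ring
    have hsum := h1.add h2
    refine (hsum.congr_of_eventuallyEq_of_mem (f₁ := g) ?_ self_mem_Ici).congr_deriv ?_
    · filter_upwards [Icc_mem_nhdsGE ht.2] with s hs
      have hsa : a ≤ s := ht.1.trans hs.1
      have hint : ∀ W : Ω → ℝ, Integrable W Q →
          Integrable (fun ω => W ω * u s (X s.toNNReal ω)) Q := fun W hW =>
        hW.mul_bdd (c := U) (hum s s) (ae_of_all _ fun ω => hUk s ⟨hsa, hs.2⟩ _)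
      simp only [hg, Pi.add_apply]
      rw [← integral_add (hint _ (hZi t ht.1))
        (hint (fun ω => Z s ω - Z t ω) ((hZi s hsa).sub (hZi t ht.1)))]
      exact integral_congr_ae (ae_of_all _ fun ω => by ring)
    -- State by state, the backward equation leaves `R k * u t k` in the first part, and the
    -- discounting cancels it.
    · rw [hX.integral_mul_comp_self (hZF t ht.1) (hZi t ht.1) fun k => -R k * u t k,
        ← Finset.sum_add_distrib]
      exact Finset.sum_eq_zero fun k _ => by ring
  have hconst := constant_of_has_deriv_right_zero hgc hgd T (right_mem_Icc.2 haT)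
  have hL : g T = ∫ ω in S, u T (X T.toNNReal ω) * discount X R a T ω ∂Q := by
    rw [hg, ← integral_indicator hSm]
    refine integral_congr_ae (ae_of_all _ fun ω => ?_)
    by_cases hωS : ω ∈ S <;> simp [hZdef, hωS, mul_comm]
  have hR' : g a = Q.real S * u a i := by
    have : ∀ ω, Z a ω * u a (X a.toNNReal ω) = S.indicator (fun _ => u a i) ω := fun ω => by
      by_cases hωS : ω ∈ S
      · have hXi : X a.toNNReal ω = i := hωS
        simp [hZdef, hωS, discount, hXi]
      · simp [hZdef, hωS]
    simp_rw [hg, this]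
    rw [integral_indicator_const _ hSm, smul_eq_mul]
  rw [← hL, hconst, hR']

end RegimeSwitching

/-! ### Regularity of the generator and the main theorem -/

namespace RegimeSwitching

variable {N : ℕ} {Ω : Type*} [mΩ : MeasurableSpace Ω] {Q : Measure Ω}
  {𝓕 : Filtration ℝ≥0 mΩ} {X : ℝ≥0 → Ω → Fin N} {A : ℝ → Matrix (Fin N) (Fin N) ℝ}

/-- A differentiable function with bounded derivative on an open interval extends continuously
to the line. -/
theorem exists_continuous_eqOn_Ioo {f : ℝ → ℝ} {a b : ℝ} (hf : DifferentiableOn ℝ f (Ioo a b))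
    (hb : BddAbove ((fun s => |deriv f s|) '' Ioo a b)) :
    ∃ g : ℝ → ℝ, Continuous g ∧ EqOn f g (Ioo a b) := by
  obtain ⟨C, hC⟩ := hb
  have hlip : LipschitzOnWith C.toNNReal f (Ioo a b) :=
    (convex_Ioo a b).lipschitzOnWith_of_nnnorm_deriv_le
      (fun x hx => (hf x hx).differentiableAt (isOpen_Ioo.mem_nhds hx)) fun x hx => by
        have := hC (mem_image_of_mem _ hx)
        rw [← NNReal.coe_le_coe, coe_nnnorm, Real.norm_eq_abs]
        exact this.trans (Real.le_coe_toNNReal C)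
  obtain ⟨g, hg, hfg⟩ := hlip.extend_real
  exact ⟨g, hg.continuous, hfg⟩

theorem IsMarkovChain.diag_eq (hX : IsMarkovChain Q 𝓕 X A) {t : ℝ} (ht : 0 ≤ t) (i : Fin N) :
    A t i i = -∑ j ∈ Finset.univ.erase i, A t i j := by
  have := hX.rate_diag t.toNNReal i
  rwa [Real.coe_toNNReal t ht] at this

/-- Under the regularity assumptions on its off-diagonal entries, the whole generator extends
continuously from the open interval `(0, T)`. -/
theorem IsMarkovChain.exists_continuous_generator (hX : IsMarkovChain Q 𝓕 X A) {T : ℝ}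
    (hA_C1 : ∀ i j, i ≠ j → ContDiffOn ℝ 1 (fun s => A s i j) (Ioo 0 T))
    (hA_deriv : ∀ i j, i ≠ j → BddAbove ((fun s => |deriv (fun u => A u i j) s|) '' Ioo 0 T)) :
    ∃ B : ℝ → Matrix (Fin N) (Fin N) ℝ, (∀ i j, Continuous fun t => B t i j) ∧
      EqOn A B (Ioo 0 T) := by
  have hoff : ∀ i j, ∃ g : ℝ → ℝ, Continuous g ∧ (i ≠ j → EqOn (fun s => A s i j) g (Ioo 0 T)) := by
    intro i j
    by_cases hij : i = j
    · exact ⟨0, continuous_zero, fun h => absurd hij h⟩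
    · obtain ⟨g, hg, hgA⟩ := exists_continuous_eqOn_Ioo
        ((hA_C1 i j hij).differentiableOn one_ne_zero) (hA_deriv i j hij)
      exact ⟨g, hg, fun _ => hgA⟩
  choose b hb hbA using hoff
  refine ⟨fun t i j => if i = j then -∑ k ∈ Finset.univ.erase i, b i k t else b i j t,
    fun i j => ?_, fun t ht => ?_⟩
  · simp only
    split_ifs
    · exact (continuous_finsetSum _ fun k _ => hb i k).neg
    · exact hb i j
  · ext i j
    simp only
    split_ifs with hij
    · subst hij
      rw [hX.diag_eq ht.1.le]
      exact congrArg _ (Finset.sum_congr rfl fun k hk => hbA i k (Finset.ne_of_mem_erase hk).symm ht)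
    · exact hbA i j hij ht

theorem IsMarkovChain.exists_neg_le_diag (hX : IsMarkovChain Q 𝓕 X A) {T : ℝ}
    (hA_sup : ∀ i j, i ≠ j → BddAbove ((fun s => |A s i j|) '' Icc 0 T)) (i : Fin N) :
    ∃ C, ∀ s ∈ Icc 0 T, -C ≤ A s i i := by
  have : ∀ j, ∃ c, i ≠ j → ∀ s ∈ Icc 0 T, A s i j ≤ c := fun j => by
    by_cases hij : i = j
    · exact ⟨0, fun h => absurd hij h⟩
    · obtain ⟨c, hc⟩ := hA_sup i j hij
      exact ⟨c, fun _ s hs => (le_abs_self _).trans (hc (mem_image_of_mem _ hs))⟩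
  choose c hc using this
  refine ⟨∑ j ∈ Finset.univ.erase i, c j, fun s hs => ?_⟩
  rw [hX.diag_eq hs.1, neg_le_neg_iff]
  exact Finset.sum_le_sum fun j hj => hc j (Finset.ne_of_mem_erase hj).symm s hs

theorem IsMarkovChain.integrable_mul_discount [IsProbabilityMeasure Q]
    (hX : IsMarkovChain Q 𝓕 X A) {R : Fin N → ℝ} (hR : ∀ i, 0 ≤ R i) (Ξ : Fin N → ℝ)
    {t T : ℝ} (htT : t ≤ T) :
    Integrable (fun ω => Ξ (X T.toNNReal ω) * discount X R t T ω) Q := by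
  obtain ⟨C, hC⟩ := (finite_range Ξ).isBounded.exists_norm_le
  have hd : AEStronglyMeasurable (discount X R t T) Q :=
    (hX.aestronglyMeasurable_discount R htT).mono (𝓕.le _)
  refine ((integrable_const C).mono'
    ((measurable_of_countable Ξ).comp (hX.measurable _)).aestronglyMeasurable
    (ae_of_all _ fun ω => hC _ (mem_range_self _))).mul_bdd (c := 1) hd (ae_of_all _ fun ω => ?_)
  rw [discount, Real.norm_eq_abs, Real.abs_exp]
  exact discount_le_one hR htT ω

theorem integrable_cond {E : Type*} [NormedAddCommGroup E] {f : Ω → E} {S : Set Ω}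
    (hf : Integrable f Q) (hS : Q S ≠ 0) : Integrable f (Q[|S]) :=
  hf.restrict.smul_measure (ENNReal.inv_ne_top.2 hS)

theorem integral_cond (f : Ω → ℝ) (S : Set Ω) :
    ∫ ω, f ω ∂(Q[|S]) = (Q.real S)⁻¹ * ∫ ω in S, f ω ∂Q := by
  rw [ProbabilityTheory.cond, integral_smul_measure, ENNReal.toReal_inv, smul_eq_mul]
  rfl

end RegimeSwitching

/-- `Q` is the risk-neutral measure and `A` the generator of the regime process `X` under `Q`.
The first two conclusions say that the conditional expectation defining the price function is
meaningful, the third that the price function is continuously differentiable. -/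
theorem mainTheorem4 {N : ℕ} {Ω : Type*} [mΩ : MeasurableSpace Ω] (Q : Measure Ω)
    [IsProbabilityMeasure Q] (𝓕 : Filtration ℝ≥0 mΩ) (X : ℝ≥0 → Ω → Fin N)
    (A : ℝ → Matrix (Fin N) (Fin N) ℝ) (hX : RegimeSwitching.IsMarkovChain Q 𝓕 X A)
    (r h L Ξ : Fin N → ℝ) (hr : ∀ i, 0 < r i) (hh : ∀ i, 0 < h i)
    (hL : ∀ i, 0 ≤ L i ∧ L i ≤ 1) (T : ℝ) (hT : 0 < T)
    (hA_inf : ∀ i j, i ≠ j → 0 < sInf ((fun s => |A s i j|) '' Icc 0 T))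
    (hA_sup : ∀ i j, i ≠ j → BddAbove ((fun s => |A s i j|) '' Icc 0 T))
    (hA_C1 : ∀ i j, i ≠ j → ContDiffOn ℝ 1 (fun s => A s i j) (Ioo 0 T))
    (hA_deriv : ∀ i j, i ≠ j → BddAbove ((fun s => |deriv (fun u => A u i j) s|) '' Ioo 0 T))
    (i : Fin N) :
    (∀ t ∈ Ioo 0 T, 0 < Q (X t.toNNReal ⁻¹' {i})) ∧
    (∀ t ∈ Ioo 0 T, Integrable (RegimeSwitching.discountedPayoff X r h L Ξ T t)
      (Q[|X t.toNNReal ⁻¹' {i}])) ∧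
    ContDiffOn ℝ 1 (RegimeSwitching.preDefaultPrice Q X r h L Ξ T i) (Ioo 0 T) := by
  set R : Fin N → ℝ := fun i => r i + h i * L i with hRdef
  have hR : ∀ i, 0 ≤ R i := fun i => add_nonneg (hr i).le (mul_nonneg (hh i).le (hL i).1)
  have hpos : ∀ t ∈ Ioo 0 T, 0 < Q (X t.toNNReal ⁻¹' {i}) := by
    obtain ⟨C, hC⟩ := hX.exists_neg_le_diag hA_sup i
    refine fun t ht => hX.measure_preimage_pos hC (fun k hk => ?_) ht.1 ht.2.le
    have hbdd : BddBelow ((fun s => |A s k i|) '' Icc 0 T) :=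
      ⟨0, forall_mem_image.2 fun s _ => abs_nonneg _⟩
    have habs : 0 < |A 0 k i| := (hA_inf k i hk).trans_le
      (csInf_le hbdd (mem_image_of_mem _ (left_mem_Icc.2 hT.le)))
    rwa [abs_of_nonneg (by simpa using hX.rate_nonneg 0 k i hk)] at habs
  refine ⟨hpos, fun t ht => RegimeSwitching.integrable_cond
    (hX.integrable_mul_discount hR Ξ ht.2.le) (hpos t ht).ne', ?_⟩
  -- Nothing makes `A` continuous at `0` or `T`, so the system is solved with `B`. Feynman–Kac is
  -- applied only from times `t > 0` and uses the equation on `[t, T)`, where `A = B`.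
  obtain ⟨B, hB, hAB⟩ := hX.exists_continuous_generator hA_C1 hA_deriv
  obtain ⟨u, huT, huc, hu'⟩ := RegimeSwitching.exists_hasDerivAt_mulVec
    (G := fun t => B t - Matrix.diagonal R) (fun j k => (hB j k).sub continuous_const) hT.le Ξ
  have hud : ∀ t ∈ Ioo 0 T, ∀ k,
      HasDerivAt (fun s => u s k) (R k * u t k - ∑ j, B t k j * u t j) t := fun t ht k => by
    refine (hu' t ht k).congr_deriv ?_
    simp [Matrix.diagonal_apply, sub_mul, Finset.sum_sub_distrib]
  have hprice : EqOn (RegimeSwitching.preDefaultPrice Q X r h L Ξ T i) (fun t => u t i)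
      (Ioo 0 T) := by
    intro t ht
    have hfk := hX.feynmanKac hR ht.1.le ht.2.le (huc.mono (Icc_subset_Icc_left ht.1.le))
      (fun s hs k => by
        have hs' : s ∈ Ioo 0 T := ⟨ht.1.trans_le hs.1, hs.2⟩
        rw [hAB hs']
        exact (hud s hs' k).hasDerivWithinAt) i
    rw [huT] at hfk
    have hne : Q.real (X t.toNNReal ⁻¹' {i}) ≠ 0 :=
      (ENNReal.toReal_pos (hpos t ht).ne' (measure_ne_top _ _)).ne'
    simp only [RegimeSwitching.preDefaultPrice, RegimeSwitching.discountedPayoff_eq,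
      RegimeSwitching.integral_cond]
    rw [hfk, inv_mul_cancel_left₀ hne]
  refine ContDiffOn.congr ?_ hprice
  rw [contDiffOn_one_iff_derivWithin isOpen_Ioo.uniqueDiffOn]
  refine ⟨fun t ht => (hud t ht i).differentiableAt.differentiableWithinAt, ?_⟩
  have huk : ∀ k, ContinuousOn (fun t => u t k) (Ioo 0 T) := fun k =>
    (continuousOn_pi.1 huc k).mono Ioo_subset_Icc_self
  have hcont : ContinuousOn (fun t => R i * u t i - ∑ j, B t i j * u t j) (Ioo 0 T) :=
    (continuousOn_const.mul (huk i)).sub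
      (continuousOn_finsetSum _ fun j _ => (hB i j).continuousOn.mul (huk j))
  -- The derivative equals the right side of the equation, which is continuous because `B` and `u`
  -- are.
  refine hcont.congr fun t ht => ?_
  rw [derivWithin_of_isOpen isOpen_Ioo ht, (hud t ht i).deriv]
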